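/- Let $L\ge 0$ and let $\ell_1,\ell_2,\dots:\mathbb R\to\mathbb R$ be independent random functions, each piecewise $L$-Lipschitz (that is, $\mathbb R$ can be partitioned into countably many regions on each of which the function is $L$-Lipschitz) and each having at most $K$ points of discontinuity. Here a random function is a random element of the space of functions $f:\mathbb R\to\mathbb R$ equipped with the smallest $\sigma$-algebra that makes all evaluations $f\mapsto f(x)$ and all events $\{f \text{ is } L\text{-Lipschitz on } [a,b]\}$ measurable, and independence refers to this $\sigma$-algebra. For $T\in\mathbb N$, $\epsilon>0$ and $\rho\in\mathbb R$ let \[ D(T,\epsilon,\rho)=\#\bigl\{1\le t\le T : \ell_t \text{ is not } L\text{-Lipschitz on } [\rho-\epsilon,\rho+\epsilon]\bigr\}. \] Then there is a universal constant $C>0$ (independent of the functions and their distribution, and of $L$, $K$, $T$, $\epsilon$) such that for all $T$ and $K$ with $TK\ge 2$ and all $\epsilon>0$ the random variable $\max_{\rho\in\mathbb R}D(T,\epsilon,\rho)$ is integrable (measurable up to a null set) and \[ \mathbb E\Bigl[\max_{\rho\in\mathbb R} D(T,\epsilon,\rho)\Bigr]\;\le\;\sup_{\rho\in\mathbb R}\mathbb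 E\bigl[D(T,\epsilon,\rho)\bigr]+C\sqrt{T\log(TK)}. \] -/

import Mathlib

open MeasureTheory ProbabilityTheory Set
open scoped NNReal

/-- `f : ℝ → ℝ` is piecewise `L`-Lipschitz: the line can be partitioned into countably many regions
(some of the `A i` may be empty, so finite partitions are included) such that the restriction of
`f` to each region is `L`-Lipschitz. -/
def IsPiecewiseLipschitz (L : ℝ≥0) (f : ℝ → ℝ) : Prop :=
  ∃ A : ℕ → Set ℝ, Pairwise (fun i j => Disjoint (A i) (A j)) ∧ (⋃ i, A i) = univ ∧
    ∀ i, LipschitzOnWith L f (A i)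

/-- The set of points at which `f` is discontinuous. -/
def discontinuities (f : ℝ → ℝ) : Set ℝ := {x | ¬ ContinuousAt f x}

/-- The σ-algebra on real functions with respect to which a random loss is a random element: the
smallest one for which the evaluations `f ↦ f x` and the events
"`f` is `L`-Lipschitz on `[a, b]`" are measurable. (The product σ-algebra alone does not see
the latter events, since they depend on uncountably many values of `f`.) -/
abbrev lossMeasurableSpace (L : ℝ≥0) : MeasurableSpace (ℝ → ℝ) :=
  MeasurableSpace.pi ⊔
    MeasurableSpace.generateFrom
      {S | ∃ a b : ℝ, S = {f : ℝ → ℝ | LipschitzOnWith L f (Icc a b)}}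

open Classical in
/-- `D(T, ε, ρ)`: the number of functions among the first `T` functions `ℓ 0, …, ℓ (T - 1)` that
are not `L`-Lipschitz on `[ρ - ε, ρ + ε]`. -/
noncomputable def nonLipschitzCount (L : ℝ≥0) (ℓ : ℕ → ℝ → ℝ) (T : ℕ) (ε ρ : ℝ) : ℕ :=
  ((Finset.range T).filter
    (fun t => ¬ LipschitzOnWith L (ℓ t) (Icc (ρ - ε) (ρ + ε)))).card

/-! A window on which a piecewise Lipschitz function fails to be Lipschitz contains a discontinuity,
and a discontinuity interior to a window forces failure. So as the centre moves, the pattern of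
failures can change only at the points `d ± ε` with `d` a discontinuity. The number of patterns is
therefore polynomial in `TK`, however many centres are used. For finitely many centres,
symmetrization (`sum_prod_mul_iSup_le`) and Massart's lemma (`sum_iSup_rademacher_le_sqrt`) turn
this count into the bound (`integral_iSup_nonLipschitzCount_le`). The patterns take finitely many
values, so this part uses only finite sums.

The passage to all real centres needs independence once more. A window can be moved to a rational
centre without losing a failure unless two different functions have discontinuities exactly `2ε`
apart, at its two endpoints. By independence this almost surely happens only where the right one
sits at an atom of its law. There are countably many atoms, so a fixed countable set of centres
almost surely attains the maximum; this also gives measurability up to a null set, and monotone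
convergence concludes. -/

/-! ### Lipschitz windows and discontinuities -/

/-- A continuous piecewise `L`-Lipschitz function is `L`-Lipschitz. -/
theorem IsPiecewiseLipschitz.lipschitzOnWith_Icc {L : ℝ≥0} {f : ℝ → ℝ}
    (hf : IsPiecewiseLipschitz L f) {a b : ℝ} (hc : ContinuousOn f (Icc a b)) :
    LipschitzOnWith L f (Icc a b) := by
  obtain ⟨A, -, hU, hA⟩ := hf
  have key : ∀ x ∈ Icc a b, ∀ y ∈ Icc a b, x ≤ y → dist (f x) (f y) ≤ L * dist x y := by
    intro x hx y hy hxy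
    have hsub : Icc x y ⊆ Icc a b := Icc_subset_Icc hx.1 hy.2
    have hc' : ContinuousOn f (Icc x y) := hc.mono hsub
    -- The pieces need not be measurable; their closures are, and continuity keeps `f` Lipschitz on
    -- them. Disjointifying the closures then makes their lengths add up.
    set C : ℕ → Set ℝ := fun i => closure (A i ∩ Icc x y) with hC
    have hCsub : ∀ i, C i ⊆ Icc x y := fun i =>
      closure_minimal inter_subset_right isClosed_Icc
    have hLip : ∀ i, LipschitzOnWith L f (C i) := fun i =>
      ((hA i).mono inter_subset_left).closure (hc'.mono (hCsub i))
    have hcov : Icc x y ⊆ ⋃ i, disjointed C i := by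
      rw [iUnion_disjointed]
      intro z hz
      have : z ∈ ⋃ i, A i := hU ▸ mem_univ z
      obtain ⟨i, hi⟩ := mem_iUnion.1 this
      exact mem_iUnion.2 ⟨i, subset_closure ⟨hi, hz⟩⟩
    have hmeas : ∀ i, MeasurableSet (disjointed C i) :=
      MeasurableSet.disjointed fun i => isClosed_closure.measurableSet
    have hpiece : ∀ i, volume (f '' disjointed C i) ≤ L * volume (disjointed C i) := fun i => by
      have := ((hLip i).mono (disjointed_subset C i)).hausdorffMeasure_image_le
        (d := 1) zero_le_one
      simpa [hausdorffMeasure_real] using this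
    -- By the intermediate value theorem, `|f x - f y|` is at most the measure of the image.
    have h1 : uIcc (f x) (f y) ⊆ f '' Icc x y := by
      have := intermediate_value_uIcc (f := f) (a := x) (b := y) (by rwa [uIcc_of_le hxy])
      rwa [uIcc_of_le hxy] at this
    have h2 : volume (uIcc (f x) (f y)) ≤ L * volume (Icc x y) := calc
      volume (uIcc (f x) (f y)) ≤ volume (⋃ i, f '' disjointed C i) :=
        measure_mono (h1.trans (by rw [← image_iUnion]; exact image_mono hcov))
      _ ≤ ∑' i, volume (f '' disjointed C i) := measure_iUnion_le _
      _ ≤ ∑' i, L * volume (disjointed C i) := ENNReal.tsum_le_tsum hpiece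
      _ = L * volume (⋃ i, disjointed C i) := by
        rw [ENNReal.tsum_mul_left, measure_iUnion (disjoint_disjointed C) hmeas]
      _ ≤ L * volume (Icc x y) := by
        gcongr
        rw [iUnion_disjointed]
        exact iUnion_subset hCsub
    rw [Real.volume_interval, Real.volume_Icc, ← ENNReal.ofReal_coe_nnreal,
      ← ENNReal.ofReal_mul L.coe_nonneg, ENNReal.ofReal_le_ofReal_iff
        (mul_nonneg L.coe_nonneg (sub_nonneg.2 hxy))] at h2
    rw [dist_comm (f x), dist_comm x, Real.dist_eq, Real.dist_eq, abs_of_nonneg (sub_nonneg.2 hxy)]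
    exact h2
  refine LipschitzOnWith.of_dist_le_mul fun x hx y hy => ?_
  rcases le_total x y with h | h
  · exact key x hx y hy h
  · rw [dist_comm, dist_comm x]
    exact key y hy x hx h

theorem not_lipschitzOnWith_Icc_of_discontinuity {L : ℝ≥0} {f : ℝ → ℝ} {a b d : ℝ}
    (hd : d ∈ discontinuities f) (had : a < d) (hdb : d < b) :
    ¬ LipschitzOnWith L f (Icc a b) := fun h =>
  hd (h.continuousOn.continuousAt (Icc_mem_nhds had hdb))

theorem IsPiecewiseLipschitz.exists_discontinuity {L : ℝ≥0} {f : ℝ → ℝ}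
    (hf : IsPiecewiseLipschitz L f) {a b : ℝ} (h : ¬ LipschitzOnWith L f (Icc a b)) :
    ∃ d ∈ discontinuities f, d ∈ Icc a b := by
  by_contra! hcon
  refine h (hf.lipschitzOnWith_Icc fun x hx => ?_)
  by_contra hx'
  exact hcon x (fun hc => hx' hc.continuousWithinAt) hx

/-- The windows centred at `ρ` and `ρ'` see the same discontinuities if no breakpoint
`d ± ε` lies between `ρ` and `ρ'`. -/
theorem IsPiecewiseLipschitz.not_lipschitzOnWith_congr {L : ℝ≥0} {f : ℝ → ℝ}
    (hf : IsPiecewiseLipschitz L f) {ε ρ ρ' : ℝ}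
    (h : ∀ d ∈ discontinuities f, d + ε ∉ uIcc ρ ρ' ∧ d - ε ∉ uIcc ρ ρ')
    (hρ : ¬ LipschitzOnWith L f (Icc (ρ - ε) (ρ + ε))) :
    ¬ LipschitzOnWith L f (Icc (ρ' - ε) (ρ' + ε)) := by
  obtain ⟨d, hd, h1, h2⟩ := hf.exists_discontinuity hρ
  obtain ⟨h3, h4⟩ := h d hd
  rw [mem_uIcc] at h3 h4
  apply not_lipschitzOnWith_Icc_of_discontinuity hd <;> by_contra! hcon
  · exact h3 (Or.inl ⟨by linarith, by linarith⟩)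
  · exact h4 (Or.inr ⟨by linarith, by linarith⟩)

/-! ### Counting window patterns -/

open Classical in
/-- The number of patterns that the windows of radius `ε` can see in finitely many functions with
at most `K` discontinuities each. -/
theorem card_image_not_lipschitzOnWith_le {ι S : Type*} [Fintype ι] [Fintype S]
    {L : ℝ≥0} {K : ℕ} {g : ι → ℝ → ℝ} (hg : ∀ i, IsPiecewiseLipschitz L (g i))
    (hK : ∀ i, (discontinuities (g i)).encard ≤ K) (ε : ℝ) (s : S → ℝ) :
    (Finset.univ.image fun (q : S) (i : ι) =>
      decide (¬ LipschitzOnWith L (g i) (Icc (s q - ε) (s q + ε)))).card ≤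
      (2 * Fintype.card ι * K + 1) ^ 2 := by
  have hfin : ∀ i, (discontinuities (g i)).Finite := fun i =>
    finite_of_encard_le_coe (hK i)
  set D : ι → Finset ℝ := fun i => (hfin i).toFinset with hD
  have hDcard : ∀ i, (D i).card ≤ K := fun i => by
    have := hK i
    rw [(hfin i).encard_eq_coe_toFinset_card] at this
    exact_mod_cast this
  set B : Finset ℝ := Finset.univ.biUnion fun i =>
    (D i).image (· + ε) ∪ (D i).image (· - ε) with hB
  have hBcard : B.card ≤ 2 * Fintype.card ι * K := calc
    B.card ≤ (Finset.univ : Finset ι).card * (2 * K) := by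
      refine Finset.card_biUnion_le_card_mul _ _ _ fun i _ => (Finset.card_union_le _ _).trans ?_
      have h1 := (Finset.card_image_le (s := D i) (f := (· + ε))).trans (hDcard i)
      have h2 := (Finset.card_image_le (s := D i) (f := (· - ε))).trans (hDcard i)
      omega
    _ = _ := by rw [Finset.card_univ]; ring
  -- Equal strict counts exclude breakpoints from the half-open interval containing the left centre,
  -- equal weak counts from the one containing the right centre; both are needed for the closed
  -- interval.
  set code : S → ℕ × ℕ := fun q =>
    ((B.filter (· < s q)).card, (B.filter (· ≤ s q)).card) with hcode
  set pat : S → ι → Bool := fun q i =>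
    decide (¬ LipschitzOnWith L (g i) (Icc (s q - ε) (s q + ε))) with hpat
  have key : ∀ q q' : S, s q < s q' → code q = code q' → ∀ x ∈ B, x ∉ uIcc (s q) (s q') := by
    intro q q' hqq h x hx hx'
    rw [uIcc_of_le hqq.le] at hx'
    have h1 : B.filter (· < s q) = B.filter (· < s q') :=
      Finset.eq_of_subset_of_card_le
        (Finset.monotone_filter_right _ fun y _ hy => lt_trans hy hqq)
        (congrArg Prod.fst h).ge
    have h2 : B.filter (· ≤ s q) = B.filter (· ≤ s q') :=
      Finset.eq_of_subset_of_card_le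
        (Finset.monotone_filter_right _ fun y _ hy => le_trans hy hqq.le)
        (congrArg Prod.snd h).ge
    have h3 : x ∈ B.filter (· ≤ s q) := h2 ▸ Finset.mem_filter.2 ⟨hx, hx'.2⟩
    have h4 : x ∈ B.filter (· < s q) :=
      h1 ▸ Finset.mem_filter.2 ⟨hx, (Finset.mem_filter.1 h3).2.trans_lt hqq⟩
    exact absurd hx'.1 (not_le.2 (Finset.mem_filter.1 h4).2)
  have hfac : pat.FactorsThrough code := by
    intro q q' h
    rcases eq_or_ne (s q) (s q') with heq | hne
    · simp only [hpat, heq]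
    have hsep : ∀ x ∈ B, x ∉ uIcc (s q) (s q') := by
      rcases hne.lt_or_gt with hlt | hlt
      · exact key q q' hlt h
      · rw [uIcc_comm]; exact key q' q hlt h.symm
    have hsep' : ∀ i, ∀ d ∈ discontinuities (g i),
        d + ε ∉ uIcc (s q) (s q') ∧ d - ε ∉ uIcc (s q) (s q') := by
      intro i d hd
      have hd' : d ∈ D i := (hfin i).mem_toFinset.2 hd
      exact ⟨hsep _ (Finset.mem_biUnion.2 ⟨i, Finset.mem_univ i,
          Finset.mem_union_left _ (Finset.mem_image_of_mem _ hd')⟩),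
        hsep _ (Finset.mem_biUnion.2 ⟨i, Finset.mem_univ i,
          Finset.mem_union_right _ (Finset.mem_image_of_mem _ hd')⟩)⟩
    funext i
    refine decide_eq_decide.2 ⟨(hg i).not_lipschitzOnWith_congr (hsep' i),
      (hg i).not_lipschitzOnWith_congr ?_⟩
    rw [uIcc_comm]
    exact hsep' i
  obtain ⟨e, he⟩ := (Function.factorsThrough_iff (f := code) pat).1 hfac
  calc (Finset.univ.image pat).card = ((Finset.univ.image code).image e).card := by
        rw [Finset.image_image, ← he]
    _ ≤ (Finset.univ.image code).card := Finset.card_image_le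
    _ ≤ (Finset.range (2 * Fintype.card ι * K + 1) ×ˢ
          Finset.range (2 * Fintype.card ι * K + 1)).card := by
        refine Finset.card_le_card (Finset.image_subset_iff.2 fun q _ => ?_)
        have h1 := (Finset.card_filter_le B (· < s q)).trans hBcard
        have h2 := (Finset.card_filter_le B (· ≤ s q)).trans hBcard
        exact Finset.mem_product.2
          ⟨Finset.mem_range.2 (Nat.lt_succ_of_le h1), Finset.mem_range.2 (Nat.lt_succ_of_le h2)⟩
    _ = (2 * Fintype.card ι * K + 1) ^ 2 := by rw [Finset.card_product, Finset.card_range, sq]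

/-! ### Massart's lemma and symmetrization -/

/-- Massart's finite class lemma, for a fixed exponential parameter `lam`. -/
theorem sum_iSup_rademacher_le {ι S : Type*} [Fintype ι] [DecidableEq ι] [Fintype S] [Nonempty S]
    (a : S → ι → ℝ) (ha : ∀ q i, |a q i| ≤ 1) {N : ℕ}
    (hN : ∀ [DecidableEq (ι → ℝ)], (Finset.univ.image a).card ≤ N) {lam : ℝ} (hlam : 0 < lam) :
    ∑ σ : ι → Bool, ⨆ q, ∑ i, (if σ i then a q i else -a q i) ≤
      2 ^ Fintype.card ι * (Real.log N / lam + lam * Fintype.card ι / 2) := by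
  classical
  set n : ℝ := (Fintype.card ι : ℝ) with hn
  set A := Finset.univ.image a with hA
  have hN : A.card ≤ N := hN
  have hApos : 0 < A.card := Finset.card_pos.2 (Finset.univ_nonempty.image a)
  have hNpos : (0 : ℝ) < N := by exact_mod_cast hApos.trans_le hN
  set M : ℝ := N * Real.exp (lam ^ 2 * n / 2) with hM
  have hMpos : 0 < M := by positivity
  have hlogM : Real.log M = Real.log N + lam ^ 2 * n / 2 := by
    rw [hM, Real.log_mul hNpos.ne' (Real.exp_pos _).ne', Real.log_exp]
  set W : (ι → Bool) → (ι → ℝ) → ℝ := fun σ x => ∑ i, (if σ i then x i else -x i) with hW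
  have hcosh : ∀ x ∈ A, ∑ σ, Real.exp (lam * W σ x) ≤
      2 ^ Fintype.card ι * Real.exp (lam ^ 2 * n / 2) := by
    intro x hx
    obtain ⟨q, -, rfl⟩ := Finset.mem_image.1 hx
    calc ∑ σ, Real.exp (lam * W σ (a q))
        = ∑ σ : ι → Bool, ∏ i, Real.exp (lam * (if σ i then a q i else -a q i)) := by
          simp only [hW, Finset.mul_sum, Real.exp_sum]
      _ = ∏ i, ∑ s : Bool, Real.exp (lam * (if s then a q i else -a q i)) := by
          rw [Finset.prod_univ_sum, Fintype.piFinset_univ]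
      _ ≤ ∏ _i : ι, 2 * Real.exp (lam ^ 2 / 2) := by
          refine Finset.prod_le_prod (fun i _ => by positivity) fun i _ => ?_
          have h1 := Real.cosh_le_exp_half_sq (lam * a q i)
          have h2 : (lam * a q i) ^ 2 / 2 ≤ lam ^ 2 / 2 := by
            have := (sq_le_one_iff_abs_le_one (a q i)).2 (ha q i)
            rw [mul_pow]
            nlinarith [sq_nonneg lam]
          have h3 := h1.trans (Real.exp_le_exp.2 h2)
          rw [Real.cosh_eq] at h3
          simp only [Fintype.sum_bool, if_true, Bool.false_eq_true, if_false, mul_neg]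
          linarith
      _ = 2 ^ Fintype.card ι * Real.exp (lam ^ 2 * n / 2) := by
          rw [Finset.prod_const, Finset.card_univ, mul_pow, ← Real.exp_nat_mul]
          congr 2
          rw [hn]; ring
  -- The tangent-line bound `y ≤ log M - 1 + exp y / M` replaces Jensen's inequality; `M` bounds the
  -- sign average of the sum of exponentials.
  have hpt : ∀ σ, (⨆ q, W σ (a q)) ≤
      ((Real.log M - 1) + (∑ x ∈ A, Real.exp (lam * W σ x)) / M) / lam := by
    intro σ
    refine ciSup_le fun q => ?_
    rw [le_div_iff₀ hlam]
    have h1 := Real.add_one_le_exp (W σ (a q) * lam - Real.log M)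
    rw [Real.exp_sub, Real.exp_log hMpos] at h1
    have h2 : Real.exp (W σ (a q) * lam) ≤ ∑ x ∈ A, Real.exp (lam * W σ x) := by
      rw [mul_comm]
      exact Finset.single_le_sum (f := fun x => Real.exp (lam * W σ x))
        (fun x _ => (Real.exp_pos _).le)
        (Finset.mem_image_of_mem a (Finset.mem_univ q))
    have h3 := div_le_div_of_nonneg_right h2 hMpos.le
    linarith
  have htot : ∑ σ, ∑ x ∈ A, Real.exp (lam * W σ x) ≤ 2 ^ Fintype.card ι * M := calc
    _ = ∑ x ∈ A, ∑ σ, Real.exp (lam * W σ x) := Finset.sum_comm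
    _ ≤ A.card • (2 ^ Fintype.card ι * Real.exp (lam ^ 2 * n / 2)) :=
      Finset.sum_le_card_nsmul _ _ _ hcosh
    _ ≤ N * (2 ^ Fintype.card ι * Real.exp (lam ^ 2 * n / 2)) := by
      rw [nsmul_eq_mul]; gcongr
    _ = _ := by rw [hM]; ring
  calc ∑ σ : ι → Bool, ⨆ q, W σ (a q)
      ≤ ∑ σ : ι → Bool, ((Real.log M - 1) + (∑ x ∈ A, Real.exp (lam * W σ x)) / M) / lam :=
        Finset.sum_le_sum fun σ _ => hpt σ
    _ = (2 ^ Fintype.card ι * (Real.log M - 1)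
          + (∑ σ, ∑ x ∈ A, Real.exp (lam * W σ x)) / M) / lam := by
        rw [← Finset.sum_div, Finset.sum_add_distrib, ← Finset.sum_div]
        simp [mul_sub]
    _ ≤ (2 ^ Fintype.card ι * (Real.log M - 1) + 2 ^ Fintype.card ι) / lam := by
        gcongr
        rwa [div_le_iff₀ hMpos]
    _ = _ := by rw [hlogM]; field_simp; ring

/-- Massart's finite class lemma. -/
theorem sum_iSup_rademacher_le_sqrt {ι S : Type*} [Fintype ι] [DecidableEq ι] [Nonempty ι]
    [Fintype S] [Nonempty S]
    (a : S → ι → ℝ) (ha : ∀ q i, |a q i| ≤ 1) {N : ℕ} {x : ℝ} (hx : 0 < x)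
    (hN : ∀ [DecidableEq (ι → ℝ)], (Finset.univ.image a).card ≤ N) (hNx : Real.log N ≤ x) :
    ∑ σ : ι → Bool, ⨆ q, ∑ i, (if σ i then a q i else -a q i) ≤
      2 ^ Fintype.card ι * √(2 * Fintype.card ι * x) := by
  have hn : (0 : ℝ) < Fintype.card ι := by exact_mod_cast Fintype.card_pos
  set n : ℝ := (Fintype.card ι : ℝ)
  have hpos : 0 < √(2 * n * x) := Real.sqrt_pos.2 (by positivity)
  have hsq : √(2 * n * x) ^ 2 = 2 * n * x := Real.sq_sqrt (by positivity)
  -- This parameter minimizes `x / lam + lam * n / 2`.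
  refine (sum_iSup_rademacher_le a ha hN (lam := √(2 * n * x) / n) (by positivity)).trans ?_
  gcongr
  calc Real.log N / (√(2 * n * x) / n) + √(2 * n * x) / n * n / 2
      ≤ x / (√(2 * n * x) / n) + √(2 * n * x) / n * n / 2 := by gcongr
    _ = √(2 * n * x) := by
      generalize √(2 * n * x) = y at hpos hsq
      field_simp
      linarith

/-- Symmetrization for a product of finite probability spaces with weights `p i`. -/
theorem sum_prod_mul_iSup_le {ι V S : Type*} [Fintype ι] [DecidableEq ι] [Nonempty ι]
    [Fintype V] [Fintype S] [Nonempty S] (p : ι → V → ℝ) (hp : ∀ i v, 0 ≤ p i v)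
    (hp1 : ∀ i, ∑ v, p i v = 1) (b : V → S → ℝ) (hb : ∀ v q, b v q ∈ Icc (0 : ℝ) 1)
    {M : ℝ} (hM : ∀ q, ∑ z : ι → V, (∏ i, p i (z i)) * ∑ i, b (z i) q ≤ M)
    {N : ℕ} {x : ℝ} (hx : 0 < x)
    (hN : ∀ [DecidableEq (ι → ℝ)] (z z' : ι → V), (∀ i, p i (z i) ≠ 0) → (∀ i, p i (z' i) ≠ 0) →
      (Finset.univ.image fun q i => b (z i) q - b (z' i) q).card ≤ N)
    (hNx : Real.log N ≤ x) :
    ∑ z : ι → V, (∏ i, p i (z i)) * ⨆ q, ∑ i, b (z i) q ≤ M + √(2 * Fintype.card ι * x) := by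
  set P : (ι → V) → ℝ := fun z => ∏ i, p i (z i) with hP
  have hP0 : ∀ z, 0 ≤ P z := fun z => Finset.prod_nonneg fun i _ => hp i _
  have hP1 : ∑ z, P z = 1 := by
    have := Finset.prod_univ_sum (fun _ : ι => (Finset.univ : Finset V)) p
    rw [Fintype.piFinset_univ] at this
    simp [hP, ← this, hp1]
  set R : (ι → V) × (ι → V) → (ι → Bool) → ℝ := fun w σ =>
    ⨆ q, ∑ i, (if σ i then b (w.1 i) q - b (w.2 i) q else -(b (w.1 i) q - b (w.2 i) q)) with hR
  set G : (ι → V) × (ι → V) → ℝ := fun w => ⨆ q, ∑ i, (b (w.1 i) q - b (w.2 i) q) with hG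
  -- Exchanging sample and ghost sample in coordinate `i` preserves the weight, as both use `p i`;
  -- identical distributions across `i` are not needed.
  have hswap : ∀ σ : ι → Bool, ∑ w : (ι → V) × (ι → V), P w.1 * P w.2 * G w =
      ∑ w : (ι → V) × (ι → V), P w.1 * P w.2 * R w σ := by
    intro σ
    set s : (ι → V) × (ι → V) → (ι → V) × (ι → V) := fun w =>
      (fun i => if σ i then w.1 i else w.2 i, fun i => if σ i then w.2 i else w.1 i) with hs
    have hinv : Function.Involutive s := by
      intro w
      ext i <;> by_cases h : σ i <;> simp [hs, h]
    rw [← Equiv.sum_comp hinv.toPerm]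
    refine Finset.sum_congr rfl fun w _ => ?_
    have h1 : P (s w).1 * P (s w).2 = P w.1 * P w.2 := by
      simp only [hP, ← Finset.prod_mul_distrib]
      refine Finset.prod_congr rfl fun i _ => ?_
      by_cases h : σ i <;> simp [hs, h, mul_comm]
    have h2 : G (s w) = R w σ := by
      simp only [hG, hR]
      refine iSup_congr fun q => Finset.sum_congr rfl fun i _ => ?_
      by_cases h : σ i <;> simp [hs, h]
    rw [Function.Involutive.coe_toPerm, h1, h2]
  have hrad : ∑ w : (ι → V) × (ι → V), P w.1 * P w.2 * G w ≤ √(2 * Fintype.card ι * x) := by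
    have h2 : (0 : ℝ) < 2 ^ Fintype.card ι := by positivity
    refine le_of_mul_le_mul_left ?_ h2
    calc 2 ^ Fintype.card ι * ∑ w : (ι → V) × (ι → V), P w.1 * P w.2 * G w
        = ∑ σ : ι → Bool, ∑ w : (ι → V) × (ι → V), P w.1 * P w.2 * R w σ := by
          simp [← hswap]
      _ = ∑ w : (ι → V) × (ι → V), P w.1 * P w.2 * ∑ σ, R w σ := by
          rw [Finset.sum_comm]
          simp only [Finset.mul_sum]
      _ ≤ ∑ w : (ι → V) × (ι → V), P w.1 * P w.2 *
            (2 ^ Fintype.card ι * √(2 * Fintype.card ι * x)) := by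
          refine Finset.sum_le_sum fun w _ => ?_
          rcases eq_or_ne (P w.1 * P w.2) 0 with h0 | h0
          · simp [h0]
          refine mul_le_mul_of_nonneg_left ?_ (mul_nonneg (hP0 _) (hP0 _))
          refine sum_iSup_rademacher_le_sqrt (fun q i => b (w.1 i) q - b (w.2 i) q) ?_ hx ?_ hNx
          · intro q i
            have h1 := hb (w.1 i) q
            have h2 := hb (w.2 i) q
            exact abs_le.2 ⟨by linarith [h1.1, h2.2], by linarith [h1.2, h2.1]⟩
          · intro _
            exact hN w.1 w.2
              (fun i => Finset.prod_ne_zero_iff.1 (left_ne_zero_of_mul h0) i (Finset.mem_univ i))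
              (fun i => Finset.prod_ne_zero_iff.1 (right_ne_zero_of_mul h0) i (Finset.mem_univ i))
      _ = _ := by
          rw [← Finset.sum_mul, Fintype.sum_prod_type]
          simp only [← Finset.mul_sum, hP1, mul_one, one_mul]
  -- The mean at each `q` is written as an average over a ghost sample `z'`, and the supremum is
  -- moved inside that average.
  have hghost : ∀ z, (⨆ q, ∑ i, b (z i) q) ≤ M + ∑ z', P z' * G (z, z') := by
    intro z
    refine ciSup_le fun q => ?_
    calc ∑ i, b (z i) q
        = ∑ z', P z' * ∑ i, b (z' i) q + ∑ z', P z' * ∑ i, (b (z i) q - b (z' i) q) := by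
          rw [← Finset.sum_add_distrib]
          simp only [← mul_add, ← Finset.sum_add_distrib, add_sub_cancel]
          rw [← Finset.sum_mul, hP1, one_mul]
      _ ≤ M + ∑ z', P z' * G (z, z') := by
          refine add_le_add (hM q) (Finset.sum_le_sum fun z' _ =>
            mul_le_mul_of_nonneg_left ?_ (hP0 z'))
          exact le_ciSup (f := fun q => ∑ i, (b (z i) q - b (z' i) q))
            (Set.finite_range _).bddAbove q
  calc ∑ z, P z * ⨆ q, ∑ i, b (z i) q
      ≤ ∑ z, P z * (M + ∑ z', P z' * G (z, z')) :=
        Finset.sum_le_sum fun z _ => mul_le_mul_of_nonneg_left (hghost z) (hP0 z)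
    _ = M + ∑ w : (ι → V) × (ι → V), P w.1 * P w.2 * G w := by
        simp only [mul_add, Finset.sum_add_distrib, Fintype.sum_prod_type]
        rw [← Finset.sum_mul, hP1, one_mul]
        simp only [Finset.mul_sum, mul_assoc]
    _ ≤ M + √(2 * Fintype.card ι * x) := by gcongr

/-! ### Discontinuities as measurable functions of the loss -/

/-- The first point after `q` near which `f` is not `L`-Lipschitz, as a supremum over rational
endpoints. -/
noncomputable def lipschitzExit (L : ℝ≥0) (q : ℚ) (f : ℝ → ℝ) : ℝ :=
  open Classical in
  ⨆ r : ℚ, if LipschitzOnWith L f (Icc (q : ℝ) (r : ℝ)) then (r : ℝ) else (q : ℝ)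

theorem measurableSet_lipschitzOnWith_Icc (L : ℝ≥0) (a b : ℝ) :
    MeasurableSet[lossMeasurableSpace L] {f : ℝ → ℝ | LipschitzOnWith L f (Icc a b)} :=
  (le_sup_right : _ ≤ lossMeasurableSpace L) _
    (MeasurableSpace.measurableSet_generateFrom ⟨a, b, rfl⟩)

theorem measurable_lipschitzExit (L : ℝ≥0) (q : ℚ) :
    Measurable[lossMeasurableSpace L] (lipschitzExit L q) := by
  classical
  let _ := lossMeasurableSpace L
  refine Measurable.iSup fun r => ?_
  convert Measurable.ite (measurableSet_lipschitzOnWith_Icc L q r) measurable_const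
    measurable_const

/-- Discontinuities are isolated, so a rational `q` just to the left of `x` has none between it and
`x`. Countably many measurable functionals thus capture every discontinuity, and independence passes
to them. -/
theorem IsPiecewiseLipschitz.exists_lipschitzExit_eq {L : ℝ≥0} {f : ℝ → ℝ}
    (hf : IsPiecewiseLipschitz L f) (hfin : (discontinuities f).Finite) {x : ℝ}
    (hx : x ∈ discontinuities f) : ∃ q : ℚ, lipschitzExit L q f = x := by
  classical
  have hnhds : (discontinuities f \ {x})ᶜ ∈ nhds x :=
    (hfin.subset sdiff_subset).isClosed.isOpen_compl.mem_nhds (by simp)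
  obtain ⟨δ, hδ, hball⟩ := Metric.mem_nhds_iff.1 hnhds
  obtain ⟨q, hq1, hq2⟩ := exists_rat_btwn (sub_lt_self x hδ)
  have hlip : ∀ r : ℚ, (r : ℝ) < x → LipschitzOnWith L f (Icc (q : ℝ) r) := by
    intro r hr
    by_contra hcon
    obtain ⟨d, hd, hd1, hd2⟩ := hf.exists_discontinuity hcon
    have hmem : d ∈ Metric.ball x δ := by
      rw [Metric.mem_ball, Real.dist_eq, abs_lt]
      constructor <;> linarith
    exact hball hmem ⟨hd, (hd2.trans_lt hr).ne⟩
  have hle : ∀ r : ℚ,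
      (if LipschitzOnWith L f (Icc (q : ℝ) r) then (r : ℝ) else (q : ℝ)) ≤ x := by
    intro r
    split_ifs with h
    · by_contra! hr
      exact not_lipschitzOnWith_Icc_of_discontinuity hx hq2 hr h
    · exact hq2.le
  refine ⟨q, le_antisymm (ciSup_le hle) ?_⟩
  refine le_of_forall_rat_lt_imp_le fun r hr => ?_
  have h1 := le_ciSup (f := fun r : ℚ =>
    if LipschitzOnWith L f (Icc (q : ℝ) (r : ℝ)) then (r : ℝ) else (q : ℝ))
    ⟨x, forall_mem_range.2 hle⟩ r
  rwa [if_pos (hlip r hr)] at h1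

/-- A random variable avoids, off its atoms, every translate of an independent one. -/
theorem ae_ne_add_of_indepFun {Ω : Type*} [MeasurableSpace Ω] {μ : Measure Ω}
    [IsProbabilityMeasure μ] {X Y : Ω → ℝ} (hX : Measurable X) (hY : Measurable Y)
    (h : IndepFun X Y μ) (c : ℝ) {A : Set ℝ} (hA : A.Countable)
    (hatom : ∀ x ∉ A, μ (X ⁻¹' {x}) = 0) : ∀ᵐ ω ∂μ, X ω = Y ω + c → X ω ∈ A := by
  have hset : MeasurableSet {p : ℝ × ℝ | p.1 = p.2 + c ∧ p.1 ∉ A} :=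
    (measurableSet_eq_fun measurable_fst (measurable_snd.add_const c)).inter
      (measurable_fst hA.measurableSet).compl
  have hprod : (μ.map fun ω => (X ω, Y ω)) = (μ.map X).prod (μ.map Y) :=
    (indepFun_iff_map_prod_eq_prod_map_map hX.aemeasurable hY.aemeasurable).1 h
  have := Measure.isProbabilityMeasure_map (μ := μ) hX.aemeasurable
  have := Measure.isProbabilityMeasure_map (μ := μ) hY.aemeasurable
  have hzero : (μ.map fun ω => (X ω, Y ω)) {p : ℝ × ℝ | p.1 = p.2 + c ∧ p.1 ∉ A} = 0 := by
    rw [hprod, Measure.prod_apply_symm hset]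
    -- By Fubini, the section at `y` is contained in the single point `y + c`, and is empty if that
    -- point lies in `A`.
    refine (lintegral_congr fun y => ?_).trans lintegral_zero
    by_cases hy : y + c ∈ A
    · refine measure_mono_null (t := ∅) ?_ measure_empty
      rintro x ⟨h1 : x = y + c, h2 : x ∉ A⟩
      exact h2 (h1 ▸ hy)
    · refine measure_mono_null (t := {y + c}) (fun x hx => hx.1) ?_
      rw [Measure.map_apply hX (measurableSet_singleton _)]
      exact hatom _ hy
  rw [Measure.map_apply (hX.prodMk hY) hset] at hzero
  filter_upwards [measure_eq_zero_iff_ae_notMem.1 hzero] with ω hω h1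
  by_contra h2
  exact hω ⟨h1, h2⟩

/-! ### Moving windows to rational centres -/

theorem nonLipschitzCount_le (L : ℝ≥0) (ℓ : ℕ → ℝ → ℝ) (T : ℕ) (ε ρ : ℝ) :
    nonLipschitzCount L ℓ T ε ρ ≤ T := by
  classical
  exact (Finset.card_filter_le _ _).trans (Finset.card_range T).le

/-- Windows can be moved to a rational centre unless two different functions have discontinuities
at the two endpoints of the window. -/
theorem exists_rat_nonLipschitzCount_ge {L : ℝ≥0} {ℓ : ℕ → ℝ → ℝ}
    (hℓ : ∀ t, IsPiecewiseLipschitz L (ℓ t)) (T : ℕ) {ε : ℝ} (hε : 0 < ε) (ρ : ℝ)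
    (hρ : ∀ s t, s ≠ t → ρ - ε ∈ discontinuities (ℓ s) → ρ + ε ∉ discontinuities (ℓ t)) :
    ∃ r : ℚ, nonLipschitzCount L ℓ T ε ρ ≤ nonLipschitzCount L ℓ T ε r := by
  classical
  set F := (Finset.range T).filter
    (fun t => ¬ LipschitzOnWith L (ℓ t) (Icc (ρ - ε) (ρ + ε))) with hF
  have hex : ∀ t, ∃ d, t ∈ F → d ∈ discontinuities (ℓ t) ∧ d ∈ Icc (ρ - ε) (ρ + ε) := by
    intro t
    by_cases ht : t ∈ F
    · obtain ⟨d, hd⟩ := (hℓ t).exists_discontinuity (Finset.mem_filter.1 ht).2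
      exact ⟨d, fun _ => hd⟩
    · exact ⟨0, fun h => absurd h ht⟩
  choose d hd using hex
  have hfinish : ∀ r : ℚ, (∀ t ∈ F, d t ∈ Ioo (r - ε : ℝ) (r + ε)) →
      nonLipschitzCount L ℓ T ε ρ ≤ nonLipschitzCount L ℓ T ε r := by
    intro r hr
    refine Finset.card_le_card fun t ht => ?_
    have ht : t ∈ F := by simpa [hF] using ht
    refine Finset.mem_filter.2 ⟨(Finset.mem_filter.1 ht).1, ?_⟩
    exact not_lipschitzOnWith_Icc_of_discontinuity (hd t ht).1 (hr t ht).1 (hr t ht).2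
  -- With no chosen discontinuity at the right end, a small shift left makes them all interior.
  -- Otherwise none is at the left end, and a shift right works.
  by_cases hcase : ∀ t ∈ F, d t < ρ + ε
  · have h1 : ∀ᶠ r in nhdsWithin ρ (Iio ρ), ∀ t ∈ F, d t ∈ Ioo (r - ε : ℝ) (r + ε) := by
      refine (Finset.eventually_all F).2 fun t ht => ?_
      have h2 : Ioo (d t - ε) ρ ∈ nhdsWithin ρ (Iio ρ) :=
        Ioo_mem_nhdsLT (by linarith [hcase t ht])
      filter_upwards [h2] with r hr
      have := (hd t ht).2.1
      exact ⟨by linarith [hr.2], by linarith [hr.1]⟩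
    obtain ⟨l, hl, hl'⟩ := (mem_nhdsLT_iff_exists_Ioo_subset' (sub_one_lt ρ)).1 h1
    obtain ⟨r, hr1, hr2⟩ := exists_rat_btwn (mem_Iio.1 hl)
    exact ⟨r, hfinish r (hl' ⟨hr1, hr2⟩)⟩
  · push Not at hcase
    obtain ⟨t, ht, htd⟩ := hcase
    have htd : ρ + ε = d t := le_antisymm htd (hd t ht).2.2
    have hcase' : ∀ s ∈ F, ρ - ε < d s := by
      intro s hs
      refine lt_of_le_of_ne (hd s hs).2.1 fun heq => ?_
      have hst : s ≠ t := by
        rintro rfl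
        linarith
      exact hρ s t hst (heq ▸ (hd s hs).1) (htd ▸ (hd t ht).1)
    have h1 : ∀ᶠ r in nhdsWithin ρ (Ioi ρ), ∀ t ∈ F, d t ∈ Ioo (r - ε : ℝ) (r + ε) := by
      refine (Finset.eventually_all F).2 fun t ht => ?_
      have h2 : Ioo ρ (d t + ε) ∈ nhdsWithin ρ (Ioi ρ) :=
        Ioo_mem_nhdsGT (by linarith [hcase' t ht])
      filter_upwards [h2] with r hr
      have := (hd t ht).2.2
      exact ⟨by linarith [hr.2], by linarith [hr.1]⟩
    obtain ⟨l, hl, hl'⟩ := (mem_nhdsGT_iff_exists_Ioo_subset' (lt_add_one ρ)).1 h1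
    obtain ⟨r, hr1, hr2⟩ := exists_rat_btwn (mem_Ioi.1 hl)
    exact ⟨r, hfinish r (hl' ⟨hr1, hr2⟩)⟩

/-! ### Finite families of windows -/

open Classical in
/-- Which of the windows of radius `ε` centred at the points `s q` see `f` as not `L`-Lipschitz. -/
noncomputable def windowPattern {S : Type*} (L : ℝ≥0) (ε : ℝ) (s : S → ℝ) (f : ℝ → ℝ) : S → Bool :=
  fun q => decide (¬ LipschitzOnWith L f (Icc (s q - ε) (s q + ε)))

theorem measurable_windowPattern {S : Type*} (L : ℝ≥0) (ε : ℝ) (s : S → ℝ) :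
    Measurable[lossMeasurableSpace L] (windowPattern L ε s) := by
  let _ := lossMeasurableSpace L
  refine measurable_pi_iff.2 fun q => measurable_to_bool ?_
  have : (fun f => windowPattern L ε s f q) ⁻¹' {true} =
      {f | LipschitzOnWith L f (Icc (s q - ε) (s q + ε))}ᶜ := by
    ext f
    simp [windowPattern]
  rw [this]
  exact (measurableSet_lipschitzOnWith_Icc L _ _).compl

theorem nonLipschitzCount_eq_sum {S : Type*} (L : ℝ≥0) (ℓ : ℕ → ℝ → ℝ) (T : ℕ) (ε : ℝ)
    (s : S → ℝ) (q : S) : (nonLipschitzCount L ℓ T ε (s q) : ℝ) =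
      ∑ i : Fin T, if windowPattern L ε s (ℓ i) q then 1 else 0 := by
  classical
  rw [nonLipschitzCount, Finset.card_filter, Finset.sum_range]
  push_cast
  refine Finset.sum_congr rfl fun i _ => ?_
  simp [windowPattern]

theorem measurable_nonLipschitzCount {Ω : Type*} [MeasurableSpace Ω] {L : ℝ≥0}
    {ℓ : ℕ → Ω → ℝ → ℝ} (hm : ∀ t, @Measurable Ω (ℝ → ℝ) _ (lossMeasurableSpace L) (ℓ t))
    (T : ℕ) (ε ρ : ℝ) :
    Measurable fun ω => (nonLipschitzCount L (fun t => ℓ t ω) T ε ρ : ℝ) := by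
  simp only [nonLipschitzCount_eq_sum L _ T ε (fun _ : Unit => ρ) ()]
  refine Finset.measurable_fun_sum _ fun i _ => ?_
  have h1 : Measurable fun ω => windowPattern L ε (fun _ : Unit => ρ) (ℓ i ω) () :=
    (measurable_pi_apply ()).comp
      (@Measurable.comp _ _ _ _ (lossMeasurableSpace L) _ _ _
        (measurable_windowPattern L ε fun _ : Unit => ρ) (hm i))
  exact (measurable_of_finite fun c : Bool => if c then (1 : ℝ) else 0).comp h1

-- Sample and ghost sample form one family of twice the size, which doubles the linear factor in the
-- pattern count.
open Classical in
theorem card_image_windowPattern_sub_le {ι S : Type*} [Fintype ι] [Fintype S]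
    {L : ℝ≥0} {K : ℕ} {g g' : ι → ℝ → ℝ} (hg : ∀ i, IsPiecewiseLipschitz L (g i))
    (hK : ∀ i, (discontinuities (g i)).encard ≤ K) (hg' : ∀ i, IsPiecewiseLipschitz L (g' i))
    (hK' : ∀ i, (discontinuities (g' i)).encard ≤ K) (ε : ℝ) (s : S → ℝ) :
    (Finset.univ.image fun (q : S) (i : ι) =>
      ((if windowPattern L ε s (g i) q then 1 else 0) -
        (if windowPattern L ε s (g' i) q then 1 else 0) : ℝ)).card ≤
      (4 * Fintype.card ι * K + 1) ^ 2 := by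
  have h := card_image_not_lipschitzOnWith_le (ι := ι ⊕ ι) (L := L) (K := K)
    (g := Sum.elim g g') (by rintro (i | i); exacts [hg i, hg' i])
    (by rintro (i | i); exacts [hK i, hK' i]) ε s
  rw [Fintype.card_sum] at h
  refine le_trans ?_ (h.trans (Nat.pow_le_pow_left (by ring_nf; rfl) 2))
  refine le_trans ?_ (Finset.card_image_le (f := fun (u : ι ⊕ ι → Bool) (i : ι) =>
    ((if u (Sum.inl i) then 1 else 0) - (if u (Sum.inr i) then 1 else 0) : ℝ)))
  rw [Finset.image_image]
  rfl

/-- The maximal inequality for finitely many windows. -/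
theorem integral_iSup_nonLipschitzCount_le {Ω S : Type*} [Fintype S] [Nonempty S]
    [MeasurableSpace Ω] {μ : Measure Ω} [IsProbabilityMeasure μ] {L : ℝ≥0} {K : ℕ}
    {ℓ : ℕ → Ω → ℝ → ℝ} (hm : ∀ t, @Measurable Ω (ℝ → ℝ) _ (lossMeasurableSpace L) (ℓ t))
    (hind : iIndepFun (m := fun _ : ℕ => lossMeasurableSpace L) ℓ μ)
    (hpl : ∀ t ω, IsPiecewiseLipschitz L (ℓ t ω))
    (hK : ∀ t ω, (discontinuities (ℓ t ω)).encard ≤ K) {T : ℕ} (ε : ℝ) (hTK : 2 ≤ T * K)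
    (s : S → ℝ) {M : ℝ}
    (hM : ∀ q, ∫ ω, (nonLipschitzCount L (fun t => ℓ t ω) T ε (s q) : ℝ) ∂μ ≤ M) :
    ∫ ω, (⨆ q, (nonLipschitzCount L (fun t => ℓ t ω) T ε (s q) : ℝ)) ∂μ ≤
      M + 4 * √((T : ℝ) * Real.log ((T : ℝ) * (K : ℝ))) := by
  classical
  have : NeZero T := ⟨by rintro rfl; omega⟩
  set Z : Fin T → Ω → S → Bool := fun i ω => windowPattern L ε s (ℓ i ω) with hZ
  have hZm : ∀ i, Measurable (Z i) := fun i =>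
    @Measurable.comp _ _ _ _ (lossMeasurableSpace L) _ _ _ (measurable_windowPattern L ε s) (hm i)
  have hZind : iIndepFun Z μ :=
    iIndepFun.comp (hind.precomp Fin.val_injective) (fun _ => windowPattern L ε s)
      fun _ => measurable_windowPattern L ε s
  have hlaw := (iIndepFun_iff_map_fun_eq_pi_map fun i => (hZm i).aemeasurable).1 hZind
  have hprob : ∀ i, IsProbabilityMeasure (μ.map (Z i)) := fun i =>
    Measure.isProbabilityMeasure_map (hZm i).aemeasurable
  set p : Fin T → (S → Bool) → ℝ := fun i v => (μ.map (Z i)).real {v} with hp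
  have hint : ∀ F : (Fin T → S → Bool) → ℝ,
      ∫ ω, F (fun i => Z i ω) ∂μ = ∑ z, (∏ i, p i (z i)) * F z := by
    intro F
    have hmeas : Measurable fun ω i => Z i ω := measurable_pi_iff.2 hZm
    rw [← integral_map (f := F) hmeas.aemeasurable (by fun_prop), hlaw,
      integral_fintype (Integrable.of_finite)]
    refine Finset.sum_congr rfl fun z _ => ?_
    rw [smul_eq_mul, Measure.real, Measure.pi_singleton, ENNReal.toReal_prod]
    rfl
  -- The pattern count applies only to patterns of actual losses; those of positive mass are
  -- realized.
  have hsupp : ∀ i v, p i v ≠ 0 → ∃ ω, Z i ω = v := by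
    intro i v h
    by_contra! hcon
    refine h ?_
    have : Z i ⁻¹' {v} = ∅ := eq_empty_of_forall_notMem hcon
    simp only [hp]
    rw [map_measureReal_apply (hZm i) (measurableSet_singleton v), this, measureReal_empty]
  -- For `y = TK ≥ 2` one has `4y + 1 ≤ y ^ 4`, so the count is at most `y ^ 8`; then `√(2 * T * x)`
  -- yields the constant `4`.
  set x : ℝ := 8 * Real.log ((T : ℝ) * K) with hx
  have hTK' : (2 : ℝ) ≤ T * K := by exact_mod_cast hTK
  have hxpos : 0 < x := mul_pos (by norm_num) (Real.log_pos (by linarith))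
  have hlog : Real.log ((4 * T * K + 1) ^ 2 : ℕ) ≤ x := by
    push_cast
    rw [Real.log_pow, hx]
    have h1 : Real.log (4 * T * K + 1) ≤ Real.log (((T : ℝ) * K) ^ 4) := by
      refine Real.log_le_log (by positivity) ?_
      nlinarith [sq_nonneg ((T : ℝ) * K), sq_nonneg (((T : ℝ) * K) ^ 2 - 4)]
    rw [Real.log_pow] at h1
    push_cast at h1 ⊢
    linarith
  have hmain := sum_prod_mul_iSup_le p (fun _ _ => measureReal_nonneg)
    (fun i => by simp [hp])
    (fun (v : S → Bool) q => if v q then 1 else 0) (fun v q => by split_ifs <;> simp)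
    (M := M) (N := (4 * T * K + 1) ^ 2) (x := x)
    (fun q => by
      rw [← hint fun z => ∑ i, if z i q then 1 else 0]
      simpa only [nonLipschitzCount_eq_sum] using hM q) hxpos
    (fun z z' hz hz' => by
      choose ω hω using fun i => hsupp i _ (hz i)
      choose ω' hω' using fun i => hsupp i _ (hz' i)
      have := card_image_windowPattern_sub_le (g := fun i : Fin T => ℓ i (ω i))
        (g' := fun i : Fin T => ℓ i (ω' i)) (fun i => hpl _ _) (fun i => hK _ _)
        (fun i => hpl _ _) (fun i => hK _ _) ε s
      rw [Fintype.card_fin] at this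
      convert this using 3
      simp only [← hω, ← hω', hZ]) hlog
  rw [← hint fun z => ⨆ q, ∑ i, if z i q then 1 else 0] at hmain
  simp only [nonLipschitzCount_eq_sum]
  refine hmain.trans (le_of_eq ?_)
  have h16 : 2 * (Fintype.card (Fin T) : ℝ) * x = 4 ^ 2 * (T * Real.log ((T : ℝ) * K)) := by
    rw [Fintype.card_fin, hx]; ring
  rw [h16, Real.sqrt_mul (by norm_num), Real.sqrt_sq (by norm_num)]

/-! ### From countably many centres to the real line -/

/-- A countable set of window centres that is almost surely as good as the whole line. -/
theorem exists_seq_forall_nonLipschitzCount_le {Ω : Type*}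
    [MeasurableSpace Ω] {μ : Measure Ω} [IsProbabilityMeasure μ] {L : ℝ≥0} {K : ℕ}
    {ℓ : ℕ → Ω → ℝ → ℝ} (hm : ∀ t, @Measurable Ω (ℝ → ℝ) _ (lossMeasurableSpace L) (ℓ t))
    (hind : iIndepFun (m := fun _ : ℕ => lossMeasurableSpace L) ℓ μ)
    (hpl : ∀ t ω, IsPiecewiseLipschitz L (ℓ t ω))
    (hK : ∀ t ω, (discontinuities (ℓ t ω)).encard ≤ K) (T : ℕ) {ε : ℝ} (hε : 0 < ε) :
    ∃ u : ℕ → ℝ, ∀ᵐ ω ∂μ, ∀ ρ, ∃ n, nonLipschitzCount L (fun t => ℓ t ω) T ε ρ ≤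
      nonLipschitzCount L (fun t => ℓ t ω) T ε (u n) := by
  set X : ℕ → ℚ → Ω → ℝ := fun t q ω => lipschitzExit L q (ℓ t ω) with hX
  have hXm : ∀ t q, Measurable (X t q) := fun t q =>
    @Measurable.comp _ _ _ _ (lossMeasurableSpace L) _ _ _ (measurable_lipschitzExit L q) (hm t)
  set A : ℕ → ℚ → Set ℝ := fun t q => {x | 0 < μ {ω | X t q ω = x}} with hA
  have hAc : ∀ t q, (A t q).Countable := fun t q =>
    Measure.countable_meas_level_set_pos (hXm t q)
  set Q : Set ℝ := range ((↑) : ℚ → ℝ) ∪ ⋃ t, ⋃ q, (· - ε) '' A t q with hQ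
  have hQc : Q.Countable := (countable_range _).union
    (countable_iUnion fun t => countable_iUnion fun q => (hAc t q).image _)
  have hae : ∀ᵐ ω ∂μ, ∀ s t, s ≠ t → ∀ q q', X t q ω = X s q' ω + 2 * ε → X t q ω ∈ A t q := by
    refine ae_all_iff.2 fun s => ae_all_iff.2 fun t => ?_
    by_cases hst : s = t
    · exact Filter.Eventually.of_forall fun ω h => absurd hst h
    have h : ∀ᵐ ω ∂μ, ∀ q q', X t q ω = X s q' ω + 2 * ε → X t q ω ∈ A t q := by
      refine ae_all_iff.2 fun q => ae_all_iff.2 fun q' => ?_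
      refine ae_ne_add_of_indepFun (hXm t q) (hXm s q') ?_ _ (hAc t q) fun x hx => ?_
      · exact IndepFun.comp (φ := lipschitzExit L q) (ψ := lipschitzExit L q')
          (hind.indepFun (Ne.symm hst)) (measurable_lipschitzExit L q)
          (measurable_lipschitzExit L q')
      · exact nonpos_iff_eq_zero.1 (not_lt.1 hx)
    filter_upwards [h] with ω hω _ using hω
  obtain ⟨u, hu⟩ := hQc.exists_eq_range ⟨_, Or.inl (mem_range_self (0 : ℚ))⟩
  refine ⟨u, ?_⟩
  filter_upwards [hae] with ω hω ρ
  have hmem : ∀ y ∈ Q, ∃ n, u n = y := fun y hy => by rwa [hu] at hy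
  by_cases hρ : ∀ s t, s ≠ t → ρ - ε ∈ discontinuities (ℓ s ω) →
      ρ + ε ∉ discontinuities (ℓ t ω)
  · obtain ⟨r, hr⟩ := exists_rat_nonLipschitzCount_ge (fun t => hpl t ω) T hε ρ hρ
    obtain ⟨n, hn⟩ := hmem r (Or.inl (mem_range_self r))
    exact ⟨n, hn ▸ hr⟩
  -- In this exceptional case `ρ + ε` is an atom, so `ρ` itself belongs to `Q`.
  · push Not at hρ
    obtain ⟨s, t, hst, hs, ht⟩ := hρ
    have hfin : ∀ t, (discontinuities (ℓ t ω)).Finite := fun t => finite_of_encard_le_coe (hK t ω)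
    obtain ⟨q, hq⟩ := (hpl t ω).exists_lipschitzExit_eq (hfin t) ht
    obtain ⟨q', hq'⟩ := (hpl s ω).exists_lipschitzExit_eq (hfin s) hs
    have hatom := hω s t hst q q' (by simp only [hX, hq, hq']; ring)
    simp only [hX, hq] at hatom
    obtain ⟨n, hn⟩ := hmem ρ
      (Or.inr (mem_iUnion.2 ⟨t, mem_iUnion.2 ⟨q, _, hatom, by ring⟩⟩))
    exact ⟨n, hn.symm ▸ le_rfl⟩

theorem mainTheorem3 :
    ∃ C : ℝ, 0 < C ∧
      ∀ (Ω : Type*) [MeasurableSpace Ω] (μ : Measure Ω) [IsProbabilityMeasure μ]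
        (L : ℝ≥0) (K : ℕ) (ℓ : ℕ → Ω → ℝ → ℝ),
        (∀ t, @Measurable Ω (ℝ → ℝ) _ (lossMeasurableSpace L) (ℓ t)) →
        iIndepFun (m := fun _ : ℕ => lossMeasurableSpace L) ℓ μ →
        (∀ t ω, IsPiecewiseLipschitz L (ℓ t ω)) →
        (∀ t ω, (discontinuities (ℓ t ω)).encard ≤ K) →
        ∀ (T : ℕ) (ε : ℝ), 2 ≤ T * K → 0 < ε →
          Integrable
              (fun ω => ⨆ ρ : ℝ, (nonLipschitzCount L (fun t => ℓ t ω) T ε ρ : ℝ)) μ ∧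
            ∫ ω, (⨆ ρ : ℝ, (nonLipschitzCount L (fun t => ℓ t ω) T ε ρ : ℝ)) ∂μ ≤
              (⨆ ρ : ℝ, ∫ ω, (nonLipschitzCount L (fun t => ℓ t ω) T ε ρ : ℝ) ∂μ) +
                C * √((T : ℝ) * Real.log ((T : ℝ) * (K : ℝ))) := by
  refine ⟨4, by norm_num, ?_⟩
  intro Ω _ μ _ L K ℓ hm hind hpl hK T ε hTK hε
  obtain ⟨u, hu⟩ := exists_seq_forall_nonLipschitzCount_le hm hind hpl hK T hε
  set D : Ω → ℝ → ℝ := fun ω ρ => (nonLipschitzCount L (fun t => ℓ t ω) T ε ρ : ℝ) with hD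
  have hD0 : ∀ ω ρ, 0 ≤ D ω ρ := fun ω ρ => Nat.cast_nonneg _
  have hDT : ∀ ω ρ, D ω ρ ≤ T := fun ω ρ =>
    Nat.cast_le.2 (nonLipschitzCount_le L (fun t => ℓ t ω) T ε ρ)
  have hDm : ∀ ρ, Measurable fun ω => D ω ρ := measurable_nonLipschitzCount hm T ε
  have hbdd : ∀ {ι : Type} (ω) (s : ι → ℝ), BddAbove (range fun i => D ω (s i)) :=
    fun ω s => ⟨T, forall_mem_range.2 fun i => hDT ω (s i)⟩
  have hintegrable : ∀ {ι : Type} [Countable ι] [Nonempty ι] (s : ι → ℝ),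
      Integrable (fun ω => ⨆ i, D ω (s i)) μ := by
    intro ι _ _ s
    refine Integrable.of_bound (Measurable.iSup fun i => hDm (s i)).aestronglyMeasurable T
      (Filter.Eventually.of_forall fun ω => ?_)
    rw [Real.norm_of_nonneg (Real.iSup_nonneg fun i => hD0 ω _)]
    exact ciSup_le fun i => hDT ω _
  have hae : (fun ω => ⨆ n, D ω (u n)) =ᵐ[μ] fun ω => ⨆ ρ, D ω ρ := by
    filter_upwards [hu] with ω hω
    refine le_antisymm (ciSup_le fun n => le_ciSup (hbdd ω id) (u n)) (ciSup_le fun ρ => ?_)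
    obtain ⟨n, hn⟩ := hω ρ
    exact (Nat.cast_le.2 hn).trans (le_ciSup (hbdd ω u) n)
  refine ⟨(hintegrable u).congr hae, ?_⟩
  rw [← integral_congr_ae hae]
  have hmean : ∀ ρ, ∫ ω, D ω ρ ∂μ ≤ ⨆ ρ, ∫ ω, D ω ρ ∂μ := by
    refine le_ciSup ⟨T, forall_mem_range.2 fun ρ => ?_⟩
    calc ∫ ω, D ω ρ ∂μ ≤ ∫ _, (T : ℝ) ∂μ :=
          integral_mono_of_nonneg (Filter.Eventually.of_forall fun ω => hD0 ω ρ)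
            (integrable_const _) (Filter.Eventually.of_forall fun ω => hDT ω ρ)
      _ = T := by simp
  -- The finite bound does not depend on `n`, so it survives monotone convergence; `n + 1` keeps the
  -- index type nonempty.
  have hmono : ∀ ω, Monotone fun n : ℕ => ⨆ i : Fin (n + 1), D ω (u i) := by
    intro ω m n hmn
    refine ciSup_le fun i => ?_
    exact le_ciSup (f := fun i : Fin (n + 1) => D ω (u i)) (hbdd ω _)
      (Fin.castLE (Nat.succ_le_succ hmn) i)
  have hlim : ∀ ω, Filter.Tendsto (fun n : ℕ => ⨆ i : Fin (n + 1), D ω (u i)) Filter.atTop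
      (nhds (⨆ n, D ω (u n))) := by
    intro ω
    have hb : BddAbove (range fun n : ℕ => ⨆ i : Fin (n + 1), D ω (u i)) :=
      ⟨T, forall_mem_range.2 fun n => ciSup_le fun i => hDT ω _⟩
    convert tendsto_atTop_ciSup (hmono ω) hb using 2
    refine le_antisymm (ciSup_le fun n => ?_)
      (ciSup_le fun n => ciSup_le fun i => le_ciSup (hbdd ω u) i)
    exact (le_ciSup (f := fun i : Fin (n + 1) => D ω (u i)) (hbdd ω _) (Fin.last n)).trans
      (le_ciSup hb n)
  refine le_of_tendsto' (integral_tendsto_of_tendsto_of_monotone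
    (fun n => hintegrable fun i : Fin (n + 1) => u i) (hintegrable u)
    (Filter.Eventually.of_forall hmono) (Filter.Eventually.of_forall hlim)) fun n => ?_
  exact integral_iSup_nonLipschitzCount_le hm hind hpl hK ε hTK (fun i : Fin (n + 1) => u i)
    fun i => hmean (u i)
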